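/- Let $(\Omega,\mathcal A,P)$ be a probability space ($P$ being the risk-neutral measure), $T\ge 0$, and $(\mathcal F_t)_{t\in[0,T]}$ a filtration. Let $r$ (the short rate) be a progressively measurable process with almost surely Lebesgue-integrable paths on $[0,T]$, let $X$ (the log-price) be an adapted real process, and let $f:\mathbb R\to\mathbb R$ be Borel. Put $B(t,s)=e^{-\int_t^s r_u\,du}$ and assume that $B(t,T)f(X_T)$ is integrable for every $t\in[0,T]$. Let $c(t,T)=\mathbf E[B(t,T)f(X_T)\mid\mathcal F_t]$, $t\in[0,T]$, be the default-free price, taken in an adapted version with almost surely càdlàg paths (assumed to exist). Let $\tau:\Omega\to[0,\infty]$ be a random variable (the default time), $H_t=\mathbf 1_{\{\tau\le t\}}$, and $\mathcal G_t=\mathcal F_t\vee\sigma(H_s,\,s\le t)$. Assume the H-hypothesis: every $(\mathcal F_t)$-martingale on $[0,T]$ is a $(\mathcal G_t)$-martingale. Assume that for each $t\in[0,T]$, $P(\tau\le t\mid\mathcal F_t)<1$ almost surely, and that the hazard process $\Gamma_t:=-\ln\bigl(1-P(\tau\le t\mid\mathcal F_t)\bigr)$ satisfies, for each $t\in[0,T]$,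 $\Gamma_t=\int_0^t\lambda_u\,du$ almost surely, for a process $\lambda$ with almost surely Lebesgue-integrable paths on $[0,T]$ (in particular $\Gamma_0=0$). Let $0\le R<1$, let $Z_t=R\,c(t,T)$ be the (fractional) recovery process, and let $$c^d(t,T)=\mathbf E\bigl[B(t,T)f(X_T)\mathbf 1_{\{\tau>T\}}+B(t,\tau)Z_\tau\mathbf 1_{\{t<\tau\le T\}}\mid\mathcal G_t\bigr],\qquad \mathrm{CVA}(t)=\mathbf 1_{\{\tau>t\}}\bigl[c(t,T)-c^d(t,T)\bigr]$$ be the price of the defaultable claim and the unilateral credit valuation adjustment. Then for every $t\in[0,T]$ all random variables under the conditional expectations in this statement are integrable and, almost surely, $$c^d(t,T)=\mathbf 1_{\{\tau>t\}}\Bigl[R\,\mathbf E\bigl(e^{-\int_t^T r_u\,du}f(X_T)\mid\mathcal F_t\bigr)+(1-R)\,\mathbf E\bigl(e^{-\int_t^T(r_u+\lambda_u)\,du}f(X_T)\mid\mathcal F_t\bigr)\Bigr],$$ $$\mathrm{CVA}(t)=\mathbf 1_{\{\tau>t\}}(1-R)\,\mathbf E\Bigl[e^{-\int_t^T r_u\,du}f(X_T)\bigl(1-e^{-\int_t^T\lambda_u\,du}\bigr)\mid\mathcal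 F_t\Bigr].$$ -/

import Mathlib

open MeasureTheory ProbabilityTheory Filter Topology
open scoped ENNReal

namespace CVA

noncomputable section

/-- The maturity `T`, as an element of the time interval `[0, T]`. -/
def maturity {T : ℝ} (hT : 0 ≤ T) : Set.Icc (0 : ℝ) T := ⟨T, Set.right_mem_Icc.2 hT⟩

/-- A function on `[0, T]` is càdlàg: right-continuous with (finite) left limits. -/
def IsCadlag {T : ℝ} (g : Set.Icc (0 : ℝ) T → ℝ) : Prop :=
  ∀ t, ContinuousWithinAt g (Set.Ioi t) t ∧ ∃ l : ℝ, Tendsto g (𝓝[<] t) (𝓝 l)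

variable {Ω : Type*} {m : MeasurableSpace Ω} {T : ℝ}

/-- The integral over `[a, b]` (for `0 ≤ a ≤ b ≤ T`) of the path at `ω` of a process indexed
by `[0, T]`. (Paths are extended to `ℝ` by constants only in order to be integrated.) -/
def pathIntegral (hT : 0 ≤ T) (Y : Set.Icc (0 : ℝ) T → Ω → ℝ) (a b : ℝ) (ω : Ω) : ℝ :=
  ∫ u in a..b, Set.IccExtend hT (fun v => Y v ω) u

/-- Almost every path of the process is Lebesgue integrable on `[0, T]`. -/
def IntegrablePaths (hT : 0 ≤ T) (P : Measure Ω) (Y : Set.Icc (0 : ℝ) T → Ω → ℝ) : Prop :=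
  ∀ᵐ ω ∂P, IntervalIntegrable (Set.IccExtend hT (fun v => Y v ω)) volume 0 T

/-- `exp (-∫ₐᵇ Y_u du)`; for `Y = r` the short rate this is the discount factor `B(a, b)`. -/
def discount (hT : 0 ≤ T) (Y : Set.Icc (0 : ℝ) T → Ω → ℝ) (a b : ℝ) (ω : Ω) : ℝ :=
  Real.exp (-pathIntegral hT Y a b ω)

/-- The event `{τ ≤ t}`. -/
def defaultBy (τ : Ω → ℝ≥0∞) (t : ℝ) : Set Ω := {ω | τ ω ≤ ENNReal.ofReal t}

/-- The event `{τ > t}`. -/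
def survivesPast (τ : Ω → ℝ≥0∞) (t : ℝ) : Set Ω := {ω | ENNReal.ofReal t < τ ω}

/-- The default indicator process `H_t = 1_{τ ≤ t}`. -/
def defaultIndicator (τ : Ω → ℝ≥0∞) (t : Set.Icc (0 : ℝ) T) : Ω → ℝ :=
  (defaultBy τ t).indicator 1

theorem stronglyMeasurable_defaultIndicator {τ : Ω → ℝ≥0∞} (hτ : Measurable τ)
    (t : Set.Icc (0 : ℝ) T) : StronglyMeasurable (defaultIndicator τ t) :=
  (stronglyMeasurable_const (b := (1 : ℝ))).indicator (measurableSet_le hτ measurable_const)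

/-- The progressive enlargement `G_t = F_t ∨ σ(H_s, s ≤ t)`. -/
def enlarged (F : Filtration (Set.Icc (0 : ℝ) T) m) {τ : Ω → ℝ≥0∞} (hτ : Measurable τ) :
    Filtration (Set.Icc (0 : ℝ) T) m :=
  F ⊔ Filtration.natural (defaultIndicator τ) (stronglyMeasurable_defaultIndicator hτ)

/-- The H-hypothesis: every `F`-martingale remains a `G`-martingale. -/
def HHypothesis (P : Measure Ω) (F G : Filtration (Set.Icc (0 : ℝ) T) m) : Prop :=
  ∀ N : Set.Icc (0 : ℝ) T → Ω → ℝ, Martingale N F P → Martingale N G P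

/-- The conditional distribution `F_t = P(τ ≤ t | F_t)` of the default time. -/
def condDefaultProb (P : Measure Ω) (F : Filtration (Set.Icc (0 : ℝ) T) m) (τ : Ω → ℝ≥0∞)
    (t : Set.Icc (0 : ℝ) T) : Ω → ℝ :=
  P[defaultIndicator τ t | F t]

/-- The hazard process `Γ_t = -ln (1 - F_t)`. -/
def hazard (P : Measure Ω) (F : Filtration (Set.Icc (0 : ℝ) T) m) (τ : Ω → ℝ≥0∞)
    (t : Set.Icc (0 : ℝ) T) (ω : Ω) : ℝ :=
  -Real.log (1 - condDefaultProb P F τ t ω)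

/-- The discounted payoff `B(t, T) f(X_T)` of the claim without default. -/
def discountedPayoff (hT : 0 ≤ T) (r X : Set.Icc (0 : ℝ) T → Ω → ℝ) (f : ℝ → ℝ)
    (t : Set.Icc (0 : ℝ) T) (ω : Ω) : ℝ :=
  discount hT r t T ω * f (X (maturity hT) ω)

/-- `c` is the càdlàg version of the default-free price process
`c(t, T) = E[B(t, T) f(X_T) | F_t]`. -/
structure IsDefaultFreePrice (hT : 0 ≤ T) (P : Measure Ω)
    (F : Filtration (Set.Icc (0 : ℝ) T) m) (r X : Set.Icc (0 : ℝ) T → Ω → ℝ) (f : ℝ → ℝ)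
    (c : Set.Icc (0 : ℝ) T → Ω → ℝ) : Prop where
  adapted : StronglyAdapted F c
  cadlag : ∀ᵐ ω ∂P, IsCadlag fun t => c t ω
  price : ∀ t, c t =ᵐ[P] P[discountedPayoff hT r X f t | F t]

/-- The discounted payoff of the defaultable claim with recovery process `Z`:
`B(t, T) f(X_T) 1_{τ > T} + B(t, τ) Z_τ 1_{t < τ ≤ T}`. -/
def defaultablePayoff (hT : 0 ≤ T) (r X : Set.Icc (0 : ℝ) T → Ω → ℝ) (f : ℝ → ℝ)
    (τ : Ω → ℝ≥0∞) (Z : Set.Icc (0 : ℝ) T → Ω → ℝ) (t : Set.Icc (0 : ℝ) T) : Ω → ℝ :=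
  (survivesPast τ T).indicator (discountedPayoff hT r X f t) +
    (survivesPast τ t ∩ defaultBy τ T).indicator (fun ω =>
      discount hT r t (τ ω).toReal ω * Set.IccExtend hT (fun v => Z v ω) (τ ω).toReal)

/-- The price `c^d(t, T) = E[B(t, T) f(X_T) 1_{τ > T} + B(t, τ) Z_τ 1_{t < τ ≤ T} | G_t]`
of the defaultable claim. -/
def defaultablePrice (hT : 0 ≤ T) (P : Measure Ω) (G : Filtration (Set.Icc (0 : ℝ) T) m)
    (r X : Set.Icc (0 : ℝ) T → Ω → ℝ) (f : ℝ → ℝ) (τ : Ω → ℝ≥0∞)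
    (Z : Set.Icc (0 : ℝ) T → Ω → ℝ) (t : Set.Icc (0 : ℝ) T) : Ω → ℝ :=
  P[defaultablePayoff hT r X f τ Z t | G t]

/-- The unilateral credit valuation adjustment `CVA(t) = 1_{τ > t} (c(t, T) - c^d(t, T))`. -/
def cva (τ : Ω → ℝ≥0∞) (c cd : Set.Icc (0 : ℝ) T → Ω → ℝ) (t : Set.Icc (0 : ℝ) T) : Ω → ℝ :=
  (survivesPast τ t).indicator (c t - cd t)

end

end CVA

/-! Write ξ = B(t,T) f(X_T) and F_s = P(τ ≤ s | F_s). The proof replaces the recovery payment by a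
multiple of ξ and then prices ξ on survival.

Recovery: B(t,s) c(s,T) = E[ξ | F_s], which equals E[ξ | G_s] by the H-hypothesis. It is thus a
closed, right-continuous G-martingale, and τ is a G-stopping time. Optional stopping
(`integrable_and_condExp_stopped`) shows that B(t,τ) c(τ,T) and ξ have the same G_t-conditional
expectation on {t < τ ≤ T}. Since 1_{t<τ≤T} = 1_{τ>t} - 1_{τ>T}, the defaultable payoff is priced
like R ξ 1_{τ>t} + (1-R) ξ 1_{τ>T}.

Survival: the first term is R 1_{τ>t} E[ξ | F_t], again by the H-hypothesis. For the second, G_t and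
F_t have the same trace on {τ > t}, so `condExp_indicator_survivesPast` gives 1_{τ>t} E[ξ
(1-F_T)/(1-F_t) | F_t]. The hazard representation identifies the ratio with exp(-∫_t^T λ). The CVA
formula follows by subtraction. -/

namespace CVA

/-! ### Optional stopping of closed right-continuous martingales. -/

section OptionalStopping

variable {Ω : Type*} {m : MeasurableSpace Ω} {P : Measure Ω} [IsProbabilityMeasure P]

/-- Optional sampling at a time taking finitely many values `s i` on disjoint events `E i`. -/
theorem setIntegral_sum_indicator_condExp {ι : Type*} [Preorder ι] {G : Filtration ι m}
    {ξ : Ω → ℝ} (hξ : Integrable ξ P) {s : ℕ → ι} {E : ℕ → Set Ω}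
    (hE : ∀ i, MeasurableSet[G (s i)] (E i)) (N : ℕ) {A : Set Ω}
    (hA : ∀ i, MeasurableSet[G (s i)] (E i ∩ A)) :
    ∫ ω in A, (∑ i ∈ Finset.range N, (E i).indicator (P[ξ | G (s i)]) ω) ∂P =
      ∫ ω in A, (∑ i ∈ Finset.range N, (E i).indicator ξ ω) ∂P := by
  have hE' : ∀ i, MeasurableSet (E i) := fun i => G.le _ _ (hE i)
  rw [integral_finsetSum _ fun i _ => (integrable_condExp.indicator (hE' i)).restrict,
    integral_finsetSum _ fun i _ => (hξ.indicator (hE' i)).restrict]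
  refine Finset.sum_congr rfl fun i _ => ?_
  have key : ∀ g : Ω → ℝ, ∫ ω in A, (E i).indicator g ω ∂P = ∫ ω in E i ∩ A, g ω ∂P := fun g => by
    rw [integral_indicator (hE' i), Measure.restrict_restrict (hE' i)]
  rw [key, key, setIntegral_condExp (G.le _) hξ (hA i)]

theorem sum_indicator_eq_of_mem {E : ℕ → Set Ω} (hd : Pairwise (Function.onFun Disjoint E))
    {N i : ℕ} (hi : i < N) {ω : Ω} (hω : ω ∈ E i) (g : ℕ → Ω → ℝ) :
    ∑ j ∈ Finset.range N, (E j).indicator (g j) ω = g i ω := by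
  rw [Finset.sum_eq_single_of_mem i (Finset.mem_range.2 hi) fun j _ hj =>
    Set.indicator_of_notMem (fun h => Set.disjoint_left.1 (hd hj) h hω) _,
    Set.indicator_of_mem hω]

/-- The martingale sampled at finitely many times is a conditional expectation of its terminal
value given the σ-algebra generated by the sampled value. -/
theorem sum_indicator_condExp_ae_eq {ι : Type*} [Preorder ι] {G : Filtration ι m}
    {ξ : Ω → ℝ} (hξ : Integrable ξ P) {s : ℕ → ι} {E : ℕ → Set Ω}
    (hE : ∀ i, MeasurableSet[G (s i)] (E i)) (hd : Pairwise (Function.onFun Disjoint E)) (N : ℕ)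
    (hN : ∀ i, N ≤ i → E i = ∅) :
    (fun ω => ∑ i ∈ Finset.range N, (E i).indicator (P[ξ | G (s i)]) ω) =ᵐ[P]
      P[fun ω => ∑ i ∈ Finset.range N, (E i).indicator ξ ω |
        MeasurableSpace.comap
          (fun ω => ∑ i ∈ Finset.range N, (E i).indicator (P[ξ | G (s i)]) ω) inferInstance] := by
  have hE' : ∀ i, MeasurableSet (E i) := fun i => G.le _ _ (hE i)
  set Y : Ω → ℝ := fun ω => ∑ i ∈ Finset.range N, (E i).indicator (P[ξ | G (s i)]) ω with hY
  have hYm : Measurable Y := Finset.measurable_fun_sum _ fun i _ =>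
    ((stronglyMeasurable_condExp.mono (G.le _)).measurable).indicator (hE' i)
  have hYi : Integrable Y P := integrable_finsetSum _ fun i _ =>
    integrable_condExp.indicator (hE' i)
  refine ae_eq_condExp_of_forall_setIntegral_eq hYm.comap_le
    (integrable_finsetSum _ fun i _ => hξ.indicator (hE' i))
    (fun _ _ _ => hYi.integrableOn) ?_
    (comap_measurable Y).stronglyMeasurable.aestronglyMeasurable
  rintro _ ⟨B, hB, rfl⟩ -
  refine setIntegral_sum_indicator_condExp hξ hE N fun i => ?_
  rcases lt_or_ge i N with hi | hi
  -- By disjointness the sum reduces on `E i` to its `i`-th term, which is `G (s i)`-measurable.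
  · have : E i ∩ Y ⁻¹' B = E i ∩ (P[ξ | G (s i)]) ⁻¹' B := by
      ext ω
      refine and_congr_right fun hω => ?_
      simp only [Set.mem_preimage, hY, sum_indicator_eq_of_mem hd hi hω]
    rw [this]
    exact (hE i).inter (stronglyMeasurable_condExp.measurable hB)
  · simp [hN i hi]

/-- The sublevel set at `a` is everything if `a ≥ s`, and is {τ ≤ a} with `a < s` otherwise. This
makes events read off τ before time `s` measurable at time `s`. -/
theorem measurable_min_of_stoppingTime {G : MeasurableSpace Ω} {τ : Ω → ℝ≥0∞} {s : ℝ}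
    (hτ : ∀ u, 0 ≤ u → u ≤ s → MeasurableSet[G] {ω | τ ω ≤ ENNReal.ofReal u}) :
    Measurable[G] fun ω => min (τ ω) (ENNReal.ofReal s) := by
  refine measurable_of_Iic fun a => ?_
  rcases le_or_gt (ENNReal.ofReal s) a with h | h
  · convert MeasurableSet.univ
    ext ω
    simp [h]
  · have ha : a ≠ ∞ := h.ne_top
    have := hτ a.toReal ENNReal.toReal_nonneg
      ((ENNReal.lt_ofReal_iff_toReal_lt ha).1 h).le
    rw [ENNReal.ofReal_toReal ha] at this
    convert this using 1
    ext ω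
    simp [not_le.2 h]

variable {T : ℝ} (hT : 0 ≤ T)

/-- The `i`-th point of the grid of mesh `1 / (n + 1)`, stopped at the maturity. -/
noncomputable def gridTime (n i : ℕ) : Set.Icc (0 : ℝ) T := Set.projIcc 0 T hT (i / (n + 1))

/-- The index of the first grid point of mesh `1 / (n + 1)` after `x`. -/
noncomputable def gridIndex (n : ℕ) (x : ℝ) : ℕ := ⌈(n + 1) * x⌉₊

theorem le_gridTime {n : ℕ} {x : ℝ} (hxT : x ≤ T) : x ≤ gridTime hT n (gridIndex n x) := by
  have h : x ≤ (gridIndex n x : ℝ) / (n + 1) := by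
    rw [le_div_iff₀ (by positivity), mul_comm]
    exact Nat.le_ceil _
  rw [gridTime, Set.coe_projIcc]
  exact le_max_of_le_right (le_min hxT h)

theorem gridTime_le {n : ℕ} {x : ℝ} (hx : 0 ≤ x) :
    (gridTime hT n (gridIndex n x) : ℝ) ≤ x + 1 / (n + 1) := by
  have h : (gridIndex n x : ℝ) / (n + 1) ≤ x + 1 / (n + 1) := by
    rw [div_le_iff₀ (by positivity)]
    have := (Nat.ceil_lt_add_one (show 0 ≤ ((n : ℝ) + 1) * x by positivity)).le
    rw [gridIndex]
    calc _ ≤ ((n : ℝ) + 1) * x + 1 := this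
      _ = _ := by field_simp
  rw [gridTime, Set.coe_projIcc]
  exact max_le (by positivity) ((min_le_right _ _).trans h)

/-- Rounding up makes the approximation come from the right, where the paths are continuous. The
limit point is included in the filter because a grid time may equal it, as always happens at `T`. -/
theorem tendsto_gridTime {x : Set.Icc (0 : ℝ) T} :
    Tendsto (fun n => gridTime hT n (gridIndex n (x : ℝ))) atTop (𝓝[≥] x) := by
  refine tendsto_nhdsWithin_iff.2 ⟨tendsto_subtype_rng.2 ?_,
    Eventually.of_forall fun n => le_gridTime hT x.2.2⟩
  refine tendsto_of_tendsto_of_tendsto_of_le_of_le tendsto_const_nhds ?_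
    (fun n => le_gridTime hT x.2.2) (fun n => gridTime_le hT x.2.1)
  simpa using tendsto_const_nhds.add (tendsto_one_div_add_atTop_nhds_zero_nat (𝕜 := ℝ))

/-- Optional stopping for a closed martingale with a right-continuous version `V`, at a stopping
time `τ`, on the event `{t < τ ≤ T}`. -/
theorem integrable_and_condExp_stopped {G : Filtration (Set.Icc (0 : ℝ) T) m} {τ : Ω → ℝ≥0∞}
    (hτ : ∀ s : Set.Icc (0 : ℝ) T, MeasurableSet[G s] (defaultBy τ s))
    {ξ : Ω → ℝ} (hξ : Integrable ξ P) {V : Set.Icc (0 : ℝ) T → Ω → ℝ} {t : Set.Icc (0 : ℝ) T}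
    (hV : ∀ s, t ≤ s → V s =ᵐ[P] P[ξ | G s])
    (hVc : ∀ᵐ ω ∂P, ∀ s, ContinuousWithinAt (fun u => V u ω) (Set.Ioi s) s) :
    Integrable ((survivesPast τ t ∩ defaultBy τ T).indicator
        fun ω => V (Set.projIcc 0 T hT (τ ω).toReal) ω) P ∧
      P[(survivesPast τ t ∩ defaultBy τ T).indicator
        fun ω => V (Set.projIcc 0 T hT (τ ω).toReal) ω | G t] =ᵐ[P]
      P[(survivesPast τ t ∩ defaultBy τ T).indicator ξ | G t] := by
  set S : Set Ω := survivesPast τ t ∩ defaultBy τ T with hS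
  set Z : Ω → ℝ := S.indicator fun ω => V (Set.projIcc 0 T hT (τ ω).toReal) ω with hZ
  have hmin : ∀ s : Set.Icc (0 : ℝ) T,
      Measurable[G s] fun ω => min (τ ω) (ENNReal.ofReal s) := fun s =>
    measurable_min_of_stoppingTime fun u hu hus =>
      G.mono (show (⟨u, hu, hus.trans s.2.2⟩ : Set.Icc (0 : ℝ) T) ≤ s from hus) _
        (hτ ⟨u, hu, hus.trans s.2.2⟩)
  have hreal : ∀ ω ∈ S, τ ω = ENNReal.ofReal (τ ω).toReal ∧ (t : ℝ) < (τ ω).toReal ∧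
      (τ ω).toReal ≤ T := fun ω hω => by
    have h2 : τ ω ≤ ENNReal.ofReal T := hω.2
    have hne : τ ω ≠ ∞ := ne_top_of_le_ne_top ENNReal.ofReal_ne_top h2
    exact ⟨(ENNReal.ofReal_toReal hne).symm, (ENNReal.ofReal_lt_iff_lt_toReal t.2.1 hne).1 hω.1,
      ENNReal.toReal_le_of_le_ofReal hT h2⟩
  -- `E n i` is the part of `S` where τ, rounded up, falls on the `i`-th grid point.
  let E : ℕ → ℕ → Set Ω := fun n i => S ∩ {ω | gridIndex n (τ ω).toReal = i}
  have hle : ∀ n i, ∀ ω ∈ E n i, τ ω ≤ ENNReal.ofReal (gridTime hT n i) := by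
    rintro n i ω ⟨hω, rfl⟩
    rw [(hreal ω hω).1]
    exact ENNReal.ofReal_le_ofReal (by
      rw [← (hreal ω hω).1]
      exact le_gridTime hT (hreal ω hω).2.2)
  have htle : ∀ n i, ∀ ω ∈ E n i, t ≤ gridTime hT n i := by
    rintro n i ω ⟨hω, rfl⟩
    exact (hreal ω hω).2.1.le.trans (le_gridTime hT (hreal ω hω).2.2)
  have hSm : ∀ n i, MeasurableSet[G (gridTime hT n i)] (E n i) := by
    intro n i
    have h1 : MeasurableSet {x : ℝ≥0∞ | ENNReal.ofReal t < x ∧ x ≤ ENNReal.ofReal T ∧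
        gridIndex n x.toReal = i} := by
      refine (measurableSet_lt measurable_const measurable_id).inter
        ((measurableSet_le measurable_id measurable_const).inter ?_)
      exact (Nat.measurable_ceil.comp (measurable_const.mul ENNReal.measurable_toReal))
        (measurableSet_singleton i)
    -- On {τ ≤ grid time}, τ agrees with its minimum with that time, so the rounded index is known
    -- by then.
    have h2 : E n i = defaultBy τ (gridTime hT n i) ∩
        (fun ω => min (τ ω) (ENNReal.ofReal (gridTime hT n i))) ⁻¹' {x : ℝ≥0∞ |
          ENNReal.ofReal t < x ∧ x ≤ ENNReal.ofReal T ∧ gridIndex n x.toReal = i} := by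
      ext ω
      constructor
      · intro h
        refine ⟨hle n i ω h, ?_⟩
        rw [Set.mem_preimage, min_eq_left (hle n i ω h)]
        exact ⟨h.1.1, h.1.2, h.2⟩
      · rintro ⟨h, h'⟩
        rw [Set.mem_preimage, min_eq_left h] at h'
        exact ⟨⟨h'.1, h'.2.1⟩, h'.2.2⟩
    rw [h2]
    exact (hτ _).inter (hmin _ h1)
  have hdisj : ∀ n, Pairwise (Function.onFun Disjoint (E n)) := fun n i j hij =>
    Set.disjoint_left.2 fun ω h h' => hij (h.2.symm.trans h'.2)
  -- The largest index, reached at τ = `T`, is the ceiling itself; the extra 1 puts it inside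
  -- `Finset.range`.
  let N : ℕ → ℕ := fun n => ⌈((n : ℝ) + 1) * T⌉₊ + 1
  have hlt : ∀ n, ∀ ω ∈ S, gridIndex n (τ ω).toReal < N n := fun n ω hω =>
    Nat.lt_succ_of_le (Nat.ceil_mono
      (mul_le_mul_of_nonneg_left (hreal ω hω).2.2 (by positivity)))
  have hempty : ∀ n i, N n ≤ i → E n i = ∅ := by
    rintro n i hi
    refine Set.eq_empty_of_forall_notMem ?_
    rintro ω ⟨hω, rfl⟩
    exact absurd (hlt n ω hω) (not_lt.2 hi)
  have hsumξ : ∀ n, (fun ω => ∑ i ∈ Finset.range (N n), (E n i).indicator ξ ω) =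
      S.indicator ξ := by
    intro n
    ext ω
    by_cases hω : ω ∈ S
    · rw [sum_indicator_eq_of_mem (hdisj n) (hlt n ω hω) (i := gridIndex n (τ ω).toReal)
        ⟨hω, rfl⟩ (fun _ => ξ), Set.indicator_of_mem hω]
    · rw [Set.indicator_of_notMem hω]
      exact Finset.sum_eq_zero fun i _ => Set.indicator_of_notMem (fun h => hω h.1) _
  let Y : ℕ → Ω → ℝ := fun n ω =>
    ∑ i ∈ Finset.range (N n), (E n i).indicator (P[ξ | G (gridTime hT n i)]) ω
  have hSmeas : MeasurableSet S := by
    have h1 : MeasurableSet (defaultBy τ (t : ℝ)) := G.le t _ (hτ t)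
    have h2 : MeasurableSet (defaultBy τ T) := G.le (maturity hT) _ (hτ (maturity hT))
    have h3 : survivesPast τ (t : ℝ) = (defaultBy τ (t : ℝ))ᶜ := by
      ext ω
      simp [survivesPast, defaultBy]
    rw [hS, h3]
    exact h1.compl.inter h2
  have hSξ : Integrable (S.indicator ξ) P := hξ.indicator hSmeas
  have hYm : ∀ n, Measurable (Y n) := fun n => Finset.measurable_fun_sum _ fun i _ =>
    ((stronglyMeasurable_condExp.mono (G.le _)).measurable).indicator (G.le _ _ (hSm n i))
  have hYi : ∀ n, Integrable (Y n) P := fun n => integrable_finsetSum _ fun i _ =>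
    integrable_condExp.indicator (G.le _ _ (hSm n i))
  -- Each `Y n` is a conditional expectation of the single integrable variable `S.indicator ξ`, and
  -- such a family is uniformly integrable. The σ-algebra generated by `Y n` does the work of the
  -- stopped σ-algebra.
  have hUI : UniformIntegrable Y 1 P := by
    refine (hSξ.uniformIntegrable_condExp fun n => (hYm n).comap_le).ae_eq fun n => ?_
    have := sum_indicator_condExp_ae_eq hξ (hSm n) (hdisj n) (N n) (hempty n)
    rw [hsumξ n] at this
    exact this.symm
  have hlim : ∀ᵐ ω ∂P, Tendsto (fun n => Y n ω) atTop (𝓝 (Z ω)) := by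
    have hVall : ∀ᵐ ω ∂P, ∀ n i, t ≤ gridTime hT n i →
        V (gridTime hT n i) ω = (P[ξ | G (gridTime hT n i)]) ω := by
      refine ae_all_iff.2 fun n => ae_all_iff.2 fun i => ?_
      by_cases h : t ≤ gridTime hT n i
      · filter_upwards [hV _ h] with ω hω _ using hω
      · exact Eventually.of_forall fun ω h' => absurd h' h
    filter_upwards [hVall, hVc] with ω h1 h2
    by_cases hω : ω ∈ S
    · have hYV : ∀ n, Y n ω = V (gridTime hT n (gridIndex n (τ ω).toReal)) ω := fun n => by
        have hmem : ω ∈ E n (gridIndex n (τ ω).toReal) := ⟨hω, rfl⟩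
        rw [h1 n _ (htle n _ ω hmem)]
        exact sum_indicator_eq_of_mem (hdisj n) (hlt n ω hω) hmem _
      have hproj : ((Set.projIcc 0 T hT (τ ω).toReal : Set.Icc (0 : ℝ) T) : ℝ) =
          (τ ω).toReal := by
        rw [Set.projIcc_of_mem hT ⟨ENNReal.toReal_nonneg, (hreal ω hω).2.2⟩]
      rw [hZ, Set.indicator_of_mem hω]
      simp_rw [hYV]
      have := tendsto_gridTime hT (x := Set.projIcc 0 T hT (τ ω).toReal)
      rw [hproj] at this
      exact (continuousWithinAt_Ioi_iff_Ici.1 (h2 _)).tendsto.comp this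
    · have hY0 : ∀ n, Y n ω = 0 := fun n =>
        Finset.sum_eq_zero fun i _ => Set.indicator_of_notMem (fun h => hω h.1) _
      rw [hZ, Set.indicator_of_notMem hω]
      simp_rw [hY0]
      exact tendsto_const_nhds
  have hZi : Integrable Z P := hUI.integrable_of_ae_tendsto hlim
  refine ⟨hZi, ?_⟩
  -- Vitali's theorem upgrades almost sure convergence to L¹ convergence, so integrals over each `A`
  -- in `G t` pass to the limit.
  have hL1 := tendsto_Lp_finite_of_tendsto_ae le_rfl ENNReal.one_ne_top
    (fun n => (hYm n).aestronglyMeasurable) (memLp_one_iff_integrable.2 hZi) hUI.2.1 hlim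
  refine (ae_eq_condExp_of_forall_setIntegral_eq (G.le t) hSξ
    (fun _ _ _ => integrable_condExp.integrableOn) (fun A hA _ => ?_)
    stronglyMeasurable_condExp.aestronglyMeasurable)
  rw [setIntegral_condExp (G.le t) hZi hA]
  refine tendsto_nhds_unique
    (tendsto_setIntegral_of_L1' Z hZi.1 (Eventually.of_forall hYi) hL1 A) ?_
  have : ∀ n, ∫ ω in A, Y n ω ∂P = ∫ ω in A, S.indicator ξ ω ∂P := by
    intro n
    rw [← hsumξ n]
    refine setIntegral_sum_indicator_condExp hξ (hSm n) (N n) fun i => ?_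
    -- A nonempty `E n i` has its grid time after `t`, so `A` already belongs to the σ-algebra of
    -- that time.
    rcases (E n i).eq_empty_or_nonempty with h | ⟨ω, hω⟩
    · simp [h]
    · exact (hSm n i).inter (G.mono (htle n i ω hω) _ hA)
  simp_rw [this]
  exact tendsto_const_nhds

end OptionalStopping

end CVA

namespace CVA

/-! ### Conditional expectations in the enlarged filtration and the H-hypothesis. -/

section Enlargement

variable {Ω : Type*} {m : MeasurableSpace Ω} {T : ℝ} {F : Filtration (Set.Icc (0 : ℝ) T) m}
  {τ : Ω → ℝ≥0∞}

theorem survivesPast_eq_compl (τ : Ω → ℝ≥0∞) (s : ℝ) : survivesPast τ s = (defaultBy τ s)ᶜ := by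
  ext ω
  simp [survivesPast, defaultBy]

theorem survivesPast_subset {s u : ℝ} (h : s ≤ u) : survivesPast τ u ⊆ survivesPast τ s :=
  fun _ hω => (ENNReal.ofReal_le_ofReal h).trans_lt hω

theorem le_enlarged (hτ : Measurable τ) (s : Set.Icc (0 : ℝ) T) : F s ≤ enlarged F hτ s :=
  le_sup_left (a := F s)

theorem measurableSet_enlarged_defaultBy (hτ : Measurable τ) (s : Set.Icc (0 : ℝ) T) :
    MeasurableSet[enlarged F hτ s] (defaultBy τ s) := by
  have h : Filtration.natural (defaultIndicator τ) (stronglyMeasurable_defaultIndicator hτ) s ≤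
    enlarged F hτ s := le_sup_right (a := F s)
  refine h _ ?_
  have h2 : MeasurableSpace.comap (defaultIndicator τ s) inferInstance ≤
      Filtration.natural (defaultIndicator τ) (stronglyMeasurable_defaultIndicator hτ) s :=
    le_iSup₂_of_le s le_rfl le_rfl
  refine h2 _ ⟨{1}, measurableSet_singleton _, ?_⟩
  ext ω
  by_cases hω : ω ∈ defaultBy τ (s : ℝ) <;> simp [defaultIndicator, hω]

/-- Before default, the enlarged filtration carries no more information than the original one. -/
theorem exists_inter_survivesPast_eq (hτ : Measurable τ) {t : Set.Icc (0 : ℝ) T} {A : Set Ω}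
    (hA : MeasurableSet[enlarged F hτ t] A) :
    ∃ B, MeasurableSet[F t] B ∧ A ∩ survivesPast τ t = B ∩ survivesPast τ t := by
  -- The sets whose trace on {τ > t} is the trace of an `F t`-set form a σ-algebra; it suffices that
  -- it contains the generators of the enlarged one.
  let H : MeasurableSpace Ω :=
    { MeasurableSet' := fun A => ∃ B, MeasurableSet[F t] B ∧
        A ∩ survivesPast τ t = B ∩ survivesPast τ t
      measurableSet_empty := ⟨∅, @MeasurableSet.empty _ (F t), rfl⟩
      measurableSet_compl := by
        rintro A ⟨B, hB, h⟩
        refine ⟨Bᶜ, @MeasurableSet.compl _ _ (F t) hB, ?_⟩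
        ext ω
        have := Set.ext_iff.1 h ω
        simp only [Set.mem_inter_iff, Set.mem_compl_iff] at this ⊢
        tauto
      measurableSet_iUnion := by
        intro A hA
        choose B hB h using hA
        refine ⟨⋃ i, B i, @MeasurableSet.iUnion _ _ (F t) _ _ hB, ?_⟩
        rw [Set.iUnion_inter, Set.iUnion_inter]
        exact Set.iUnion_congr h }
  have hle : enlarged F hτ t ≤ H := by
    refine sup_le (fun A hA => ⟨A, hA, rfl⟩) (iSup₂_le fun s hs => ?_)
    rintro _ ⟨B, -, rfl⟩
    have h0 : ∀ ω ∈ survivesPast τ (t : ℝ), defaultIndicator τ s ω = 0 := fun ω hω =>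
      Set.indicator_of_notMem (by
        have := survivesPast_subset (τ := τ) (show (s : ℝ) ≤ t from hs) hω
        rw [survivesPast_eq_compl] at this
        exact this) _
    -- For `s ≤ t` the default indicator vanishes on {τ > t}, so the trace of its preimage of `B` is
    -- everything or nothing.
    by_cases hB : (0 : ℝ) ∈ B
    · refine ⟨Set.univ, @MeasurableSet.univ _ (F t), ?_⟩
      ext ω
      simp only [Set.mem_inter_iff, Set.mem_preimage, Set.mem_univ, true_and,
        and_iff_right_iff_imp]
      intro hω
      rwa [h0 ω hω]
    · refine ⟨∅, @MeasurableSet.empty _ (F t), ?_⟩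
      ext ω
      simp only [Set.mem_inter_iff, Set.mem_preimage, Set.mem_empty_iff_false, false_and,
        iff_false, not_and]
      intro h hω
      rw [h0 ω hω] at h
      exact hB h
  exact hle A hA

theorem measurableSet_survivesPast (hτ : Measurable τ) (s : ℝ) :
    MeasurableSet (survivesPast τ s) := measurableSet_lt measurable_const hτ

variable {P : Measure Ω} {ξ : Ω → ℝ}

theorem condDefaultProb_nonneg (t : Set.Icc (0 : ℝ) T) : 0 ≤ᵐ[P] condDefaultProb P F τ t :=
  condExp_nonneg (Eventually.of_forall fun ω => Set.indicator_nonneg (fun _ _ => zero_le_one) ω)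

theorem integrable_mul_condDefaultProb {g : Ω → ℝ} (hgi : Integrable g P)
    {s : Set.Icc (0 : ℝ) T} (hlt : ∀ᵐ ω ∂P, condDefaultProb P F τ s ω < 1) :
    Integrable (fun ω => g ω * condDefaultProb P F τ s ω) P := by
  refine hgi.mul_bdd (c := 1) (stronglyMeasurable_condExp.mono (F.le s)).aestronglyMeasurable ?_
  filter_upwards [hlt, condDefaultProb_nonneg (P := P) (F := F) (τ := τ) s] with ω h1 h2
  rw [Real.norm_eq_abs, abs_le]
  have h2' : 0 ≤ condDefaultProb P F τ s ω := h2
  constructor <;> linarith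

variable [IsProbabilityMeasure P]

/-- Under the H-hypothesis, `F_T`-measurable random variables have the same conditional
expectations given `G_s` and given `F_s`. -/
theorem HHypothesis.condExp_ae_eq (hT : 0 ≤ T) {G : Filtration (Set.Icc (0 : ℝ) T) m}
    (hH : HHypothesis P F G) (hξ : StronglyMeasurable[F (maturity hT)] ξ) (hξi : Integrable ξ P)
    (s : Set.Icc (0 : ℝ) T) : P[ξ | G s] =ᵐ[P] P[ξ | F s] := by
  have h := (hH _ (martingale_condExp ξ F P)).2 s (maturity hT) s.2.2
  dsimp only at h
  rwa [condExp_of_stronglyMeasurable (F.le _) hξ hξi] at h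

theorem integrable_defaultIndicator (hτ : Measurable τ) (s : Set.Icc (0 : ℝ) T) :
    Integrable (defaultIndicator τ s) P :=
  (integrable_const (1 : ℝ)).indicator (measurableSet_le hτ measurable_const)

/-- For A ∈ F_T, self-adjointness of conditional expectation gives E[1_A F_t] = E[E[1_A | F_t]
1_{τ≤t}]. The H-hypothesis turns F_t into G_t in the inner expectation, and {τ ≤ t} ∈ G_t then gives
P(A ∩ {τ ≤ t}). -/
theorem condDefaultProb_ae_eq_condExp_maturity (hT : 0 ≤ T) (hτ : Measurable τ)
    (hH : HHypothesis P F (enlarged F hτ)) (t : Set.Icc (0 : ℝ) T) :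
    condDefaultProb P F τ t =ᵐ[P] P[defaultIndicator τ t | F (maturity hT)] := by
  have htT : t ≤ maturity hT := t.2.2
  have hDi := integrable_defaultIndicator (P := P) hτ t
  have hDm : MeasurableSet (defaultBy τ (t : ℝ)) := measurableSet_le hτ measurable_const
  refine ae_eq_condExp_of_forall_setIntegral_eq (F.le _) hDi
    (fun _ _ _ => integrable_condExp.integrableOn) (fun A hA _ => ?_)
    (stronglyMeasurable_condExp.mono (F.mono htT)).aestronglyMeasurable
  have hAm : MeasurableSet A := F.le _ _ hA
  set a : Ω → ℝ := A.indicator 1 with ha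
  have haF : StronglyMeasurable[F (maturity hT)] a := stronglyMeasurable_one.indicator hA
  have hai : Integrable a P := (integrable_const (1 : ℝ)).indicator hAm
  have hmulA : ∀ g : Ω → ℝ, a * g = A.indicator g := fun g => by
    ext ω
    by_cases h : ω ∈ A <;> simp [ha, h]
  have hmulD : ∀ g : Ω → ℝ, g * defaultIndicator τ t = (defaultBy τ (t : ℝ)).indicator g :=
    fun g => by
      ext ω
      by_cases h : ω ∈ defaultBy τ (t : ℝ) <;> simp [defaultIndicator, h]
  have h1 : P[a * condDefaultProb P F τ t | F t] =ᵐ[P] P[a | F t] * condDefaultProb P F τ t :=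
    condExp_mul_of_stronglyMeasurable_right stronglyMeasurable_condExp
      (by rw [hmulA]; exact integrable_condExp.indicator hAm) hai
  have h2 : P[P[a | F t] * defaultIndicator τ t | F t] =ᵐ[P]
      P[a | F t] * condDefaultProb P F τ t :=
    condExp_mul_of_stronglyMeasurable_left stronglyMeasurable_condExp
      (by rw [hmulD]; exact integrable_condExp.indicator hDm) hDi
  calc ∫ ω in A, condDefaultProb P F τ t ω ∂P
      = ∫ ω, (a * condDefaultProb P F τ t) ω ∂P := by rw [hmulA, integral_indicator hAm]
    _ = ∫ ω, (P[a * condDefaultProb P F τ t | F t]) ω ∂P := (integral_condExp (F.le _)).symm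
    _ = ∫ ω, (P[P[a | F t] * defaultIndicator τ t | F t]) ω ∂P :=
        integral_congr_ae (h1.trans h2.symm)
    _ = ∫ ω, (P[a | F t] * defaultIndicator τ t) ω ∂P := integral_condExp (F.le _)
    _ = ∫ ω in defaultBy τ (t : ℝ), (P[a | F t]) ω ∂P := by
        rw [hmulD, integral_indicator hDm]
    _ = ∫ ω in defaultBy τ (t : ℝ), (P[a | enlarged F hτ t]) ω ∂P :=
        integral_congr_ae (ae_restrict_of_ae (hH.condExp_ae_eq hT haF hai t).symm)
    _ = ∫ ω in defaultBy τ (t : ℝ), a ω ∂P :=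
        setIntegral_condExp ((enlarged F hτ).le _) hai (measurableSet_enlarged_defaultBy hτ t)
    _ = ∫ ω, (a * defaultIndicator τ t) ω ∂P := by rw [hmulD, integral_indicator hDm]
    _ = ∫ ω in A, defaultIndicator τ t ω ∂P := by rw [hmulA, integral_indicator hAm]

/-- Once both probabilities are conditioned on the same σ-algebra F_T, the inclusion of events
compares them. This later bounds exp(-∫_t^T λ) by 1 without a sign condition on λ. -/
theorem condDefaultProb_mono (hT : 0 ≤ T) (hτ : Measurable τ)
    (hH : HHypothesis P F (enlarged F hτ)) (t : Set.Icc (0 : ℝ) T) :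
    condDefaultProb P F τ t ≤ᵐ[P] condDefaultProb P F τ (maturity hT) := by
  have h : P[defaultIndicator τ t | F (maturity hT)] ≤ᵐ[P]
      P[defaultIndicator τ (maturity hT) | F (maturity hT)] :=
    condExp_mono (integrable_defaultIndicator hτ _) (integrable_defaultIndicator hτ _)
      (Eventually.of_forall fun ω => Set.indicator_le_indicator_of_subset
        (fun ω hω => le_trans (α := ℝ≥0∞) hω (ENNReal.ofReal_le_ofReal t.2.2))
        (fun _ => zero_le_one) ω)
  exact (condDefaultProb_ae_eq_condExp_maturity hT hτ hH t).le.trans h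

/-- Against F_s-measurable factors, 1_{τ>s} may be replaced by its conditional expectation 1 - F_s.
It is used both at `t` and at maturity. -/
theorem setIntegral_indicator_survivesPast (hτ : Measurable τ) {s : Set.Icc (0 : ℝ) T}
    {g : Ω → ℝ} (hg : StronglyMeasurable[F s] g) (hgi : Integrable g P) {A : Set Ω}
    (hA : MeasurableSet[F s] A)
    (hgq : Integrable (fun ω => g ω * condDefaultProb P F τ s ω) P) :
    ∫ ω in A, (survivesPast τ s).indicator g ω ∂P =
      ∫ ω in A, g ω * (1 - condDefaultProb P F τ s ω) ∂P := by
  have hDm : MeasurableSet (defaultBy τ (s : ℝ)) := measurableSet_le hτ measurable_const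
  have hmulD : g * defaultIndicator τ s = (defaultBy τ (s : ℝ)).indicator g := by
    ext ω
    by_cases h : ω ∈ defaultBy τ (s : ℝ) <;> simp [defaultIndicator, h]
  have hgD : Integrable (g * defaultIndicator τ s) P := by
    rw [hmulD]
    exact hgi.indicator hDm
  have h1 : (survivesPast τ (s : ℝ)).indicator g = g - g * defaultIndicator τ s := by
    rw [hmulD, survivesPast_eq_compl, Set.indicator_compl]
  have h2 : P[g * defaultIndicator τ s | F s] =ᵐ[P] g * condDefaultProb P F τ s :=
    condExp_mul_of_stronglyMeasurable_left hg hgD (integrable_defaultIndicator hτ s)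
  have h3 : ∫ ω in A, (g * defaultIndicator τ s) ω ∂P =
      ∫ ω in A, g ω * condDefaultProb P F τ s ω ∂P := by
    rw [← setIntegral_condExp (F.le s) hgD hA]
    exact integral_congr_ae (ae_restrict_of_ae h2)
  simp only [h1, Pi.sub_apply, mul_sub, mul_one]
  rw [integral_sub hgi.restrict hgD.restrict, h3, integral_sub hgi.restrict hgq.restrict]

/-- Conditional expectation of a claim paid on survival, through the ratio `D` of the conditional
survival probabilities. -/
theorem condExp_indicator_survivesPast (hT : 0 ≤ T) (hτ : Measurable τ)
    (hF_lt : ∀ t, ∀ᵐ ω ∂P, condDefaultProb P F τ t ω < 1)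
    (hξ : StronglyMeasurable[F (maturity hT)] ξ) (hξi : Integrable ξ P) {D : Ω → ℝ}
    {t : Set.Icc (0 : ℝ) T} (hD : ∀ᵐ ω ∂P, D ω * (1 - condDefaultProb P F τ t ω) =
      1 - condDefaultProb P F τ (maturity hT) ω)
    (hξD : Integrable (fun ω => ξ ω * D ω) P) :
    P[(survivesPast τ T).indicator ξ | enlarged F hτ t] =ᵐ[P]
      (survivesPast τ t).indicator (P[fun ω => ξ ω * D ω | F t]) := by
  have hq : ∀ s : Set.Icc (0 : ℝ) T, MeasurableSet (survivesPast τ (s : ℝ)) := fun s =>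
    measurableSet_survivesPast hτ s
  have hmT : MeasurableSet (survivesPast τ T) := measurableSet_survivesPast hτ T
  set g : Ω → ℝ := P[fun ω => ξ ω * D ω | F t] with hg
  have hgi : Integrable g P := integrable_condExp
  refine (ae_eq_condExp_of_forall_setIntegral_eq ((enlarged F hτ).le t) (hξi.indicator hmT)
    (fun _ _ _ => (hgi.indicator (hq t)).integrableOn) (fun A hA _ => ?_) ?_).symm
  swap
  · refine (StronglyMeasurable.indicator
      (stronglyMeasurable_condExp.mono (le_enlarged hτ t)) ?_).aestronglyMeasurable
    rw [survivesPast_eq_compl]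
    exact (measurableSet_enlarged_defaultBy hτ t).compl
  -- Both integrands vanish off {τ > t}, so the G_t-set `A` can be traded for the F_t-set `B`.
  obtain ⟨B, hB, hAB⟩ := exists_inter_survivesPast_eq hτ hA
  have hswap : ∀ h : Ω → ℝ, ∫ ω in A, (survivesPast τ (t : ℝ)).indicator h ω ∂P =
      ∫ ω in B, (survivesPast τ (t : ℝ)).indicator h ω ∂P := fun h => by
    rw [setIntegral_indicator (hq t), setIntegral_indicator (hq t), hAB]
  have hB' : MeasurableSet[F (maturity hT)] B := F.mono (show t ≤ maturity hT from t.2.2) _ hB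
  have hTt : (survivesPast τ T).indicator ξ =
      (survivesPast τ (t : ℝ)).indicator ((survivesPast τ T).indicator ξ) := by
    rw [Set.indicator_indicator,
      Set.inter_eq_right.2 (survivesPast_subset (τ := τ) t.2.2)]
  have hgq : Integrable (fun ω => g ω * condDefaultProb P F τ t ω) P :=
    integrable_mul_condDefaultProb hgi (hF_lt t)
  have hξDq : Integrable (fun ω => ξ ω * D ω * (1 - condDefaultProb P F τ t ω)) P := by
    simp only [mul_sub, mul_one]
    exact hξD.sub (integrable_mul_condDefaultProb hξD (hF_lt t))
  have hpull : P[fun ω => ξ ω * D ω * (1 - condDefaultProb P F τ t ω) | F t] =ᵐ[P]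
      fun ω => g ω * (1 - condDefaultProb P F τ t ω) :=
    condExp_mul_of_stronglyMeasurable_right (f := fun ω => ξ ω * D ω)
      (g := fun ω => 1 - condDefaultProb P F τ t ω)
      (stronglyMeasurable_const.sub stronglyMeasurable_condExp) hξDq hξD
  rw [hswap, hTt, hswap, ← hTt,
    setIntegral_indicator_survivesPast hτ stronglyMeasurable_condExp hgi hB hgq]
  have hTm := setIntegral_indicator_survivesPast (s := maturity hT) hτ hξ hξi hB'
    (integrable_mul_condDefaultProb hξi (hF_lt _))
  -- It remains to compare ∫_B g (1-F_t) with ∫_B ξ (1-F_T). The F_t-measurable factor 1-F_t moves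
  -- inside the conditional expectation defining `g`, where `hD` applies.
  refine Eq.trans ?_ hTm.symm
  rw [← integral_congr_ae (ae_restrict_of_ae hpull), setIntegral_condExp (F.le t) hξDq hB]
  refine integral_congr_ae (ae_restrict_of_ae ?_)
  filter_upwards [hD] with ω hω
  rw [mul_assoc, hω]

end Enlargement

end CVA

namespace CVA

/-! ### Discount factors, the discounted price martingale and the intensity. -/

section Discount

theorem stronglyMeasurable_integral_comp {Ω α β : Type*} {mΩ : MeasurableSpace Ω}
    [MeasurableSpace α] [MeasurableSpace β] {φ : α → β} (hφ : Measurable φ) {g : β × Ω → ℝ}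
    (hg : StronglyMeasurable g) (μ : Measure α) [SFinite μ] :
    StronglyMeasurable fun ω => ∫ u, g (φ u, ω) ∂μ :=
  (hg.comp_measurable (hφ.prodMap measurable_id)).integral_prod_left'

variable {Ω : Type*} {m : MeasurableSpace Ω} {T : ℝ} {hT : 0 ≤ T}
  {F : Filtration (Set.Icc (0 : ℝ) T) m} {P : Measure Ω}
  {Y Y' : Set.Icc (0 : ℝ) T → Ω → ℝ} {ω : Ω}

theorem intervalIntegrable_of_mem
    (hY : IntervalIntegrable (Set.IccExtend hT (fun v => Y v ω)) volume 0 T)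
    {a b : ℝ} (ha : a ∈ Set.Icc 0 T) (hb : b ∈ Set.Icc 0 T) :
    IntervalIntegrable (Set.IccExtend hT (fun v => Y v ω)) volume a b :=
  hY.mono_set (Set.uIcc_subset_uIcc (by rwa [Set.uIcc_of_le hT]) (by rwa [Set.uIcc_of_le hT]))

theorem pathIntegral_add_adjacent
    (hY : IntervalIntegrable (Set.IccExtend hT (fun v => Y v ω)) volume 0 T)
    {a b d : ℝ} (ha : a ∈ Set.Icc 0 T) (hb : b ∈ Set.Icc 0 T) (hd : d ∈ Set.Icc 0 T) :
    pathIntegral hT Y a b ω + pathIntegral hT Y b d ω = pathIntegral hT Y a d ω :=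
  intervalIntegral.integral_add_adjacent_intervals (intervalIntegrable_of_mem hY ha hb)
    (intervalIntegrable_of_mem hY hb hd)

theorem discount_mul_discount
    (hY : IntervalIntegrable (Set.IccExtend hT (fun v => Y v ω)) volume 0 T)
    {a b d : ℝ} (ha : a ∈ Set.Icc 0 T) (hb : b ∈ Set.Icc 0 T) (hd : d ∈ Set.Icc 0 T) :
    discount hT Y a b ω * discount hT Y b d ω = discount hT Y a d ω := by
  rw [discount, discount, discount, ← Real.exp_add, ← pathIntegral_add_adjacent hY ha hb hd,
    neg_add]

theorem discount_add
    (hY : IntervalIntegrable (Set.IccExtend hT (fun v => Y v ω)) volume 0 T)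
    (hY' : IntervalIntegrable (Set.IccExtend hT (fun v => Y' v ω)) volume 0 T)
    {a b : ℝ} (ha : a ∈ Set.Icc 0 T) (hb : b ∈ Set.Icc 0 T) :
    discount hT (fun u ω => Y u ω + Y' u ω) a b ω =
      discount hT Y a b ω * discount hT Y' a b ω := by
  rw [discount, discount, discount, ← Real.exp_add, ← neg_add]
  congr 2
  exact intervalIntegral.integral_add (intervalIntegrable_of_mem hY ha hb)
    (intervalIntegrable_of_mem hY' ha hb)

theorem continuous_discount
    (hY : IntervalIntegrable (Set.IccExtend hT (fun v => Y v ω)) volume 0 T)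
    (a : Set.Icc (0 : ℝ) T) :
    Continuous fun s : Set.Icc (0 : ℝ) T => discount hT Y a s ω := by
  have h : ContinuousOn (fun s : ℝ => pathIntegral hT Y a s ω) (Set.uIcc 0 T) :=
    intervalIntegral.continuousOn_primitive_interval' hY (by
      rw [Set.uIcc_of_le hT]
      exact a.2)
  rw [Set.uIcc_of_le hT] at h
  exact Real.continuous_exp.comp h.domRestrict.neg

theorem stronglyMeasurable_discount (hY : IsStronglyProgressive F Y) {a s : Set.Icc (0 : ℝ) T}
    (has : a ≤ s) : StronglyMeasurable[F s] (discount hT Y a s) := by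
  -- Capping time at `s` changes nothing on (a, s] and lands in `Set.Iic s`, where progressive
  -- measurability gives joint measurability with respect to `F s`; Fubini then applies.
  let φ : ℝ → Set.Iic s := fun u => ⟨Set.projIcc 0 T hT (min u s), by
    have := Set.monotone_projIcc hT (min_le_right u (s : ℝ))
    rwa [Set.projIcc_val] at this⟩
  have hφ : Measurable φ :=
    (continuous_projIcc.comp (continuous_id.min continuous_const)).measurable.subtype_mk
  have h2 : StronglyMeasurable[F s] fun ω =>
      ∫ u, Y (φ u) ω ∂(volume.restrict (Set.Ioc (a : ℝ) s)) :=
    stronglyMeasurable_integral_comp hφ (hY s) _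
  have h3 : pathIntegral hT Y a s = fun ω =>
      ∫ u, Y (φ u) ω ∂(volume.restrict (Set.Ioc (a : ℝ) s)) := by
    ext ω
    rw [pathIntegral, intervalIntegral.integral_of_le has]
    refine setIntegral_congr_fun measurableSet_Ioc fun u hu => ?_
    simp only [φ, Set.IccExtend, Function.comp_apply, min_eq_left hu.2]
  rw [← h3] at h2
  exact Real.continuous_exp.comp_stronglyMeasurable h2.neg

theorem stronglyMeasurable_discountedPayoff {X : Set.Icc (0 : ℝ) T → Ω → ℝ} {f : ℝ → ℝ}
    (hY : IsStronglyProgressive F Y) (hX : StronglyAdapted F X) (hf : Measurable f)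
    (t : Set.Icc (0 : ℝ) T) :
    StronglyMeasurable[F (maturity hT)] (discountedPayoff hT Y X f t) :=
  (stronglyMeasurable_discount hY (s := maturity hT) t.2.2).mul
    (hf.comp (hX (maturity hT)).measurable).stronglyMeasurable

/-- B(t,s) is F_s-measurable and B(t,s) B(s,T) = B(t,T), so it can be pulled into the conditional
expectation: the price discounted to `t` is a martingale closed by the payoff. -/
theorem discount_mul_price_ae_eq {X c : Set.Icc (0 : ℝ) T → Ω → ℝ} {f : ℝ → ℝ}
    (hY : IsStronglyProgressive F Y) (hYi : IntegrablePaths hT P Y)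
    (hpayoff : ∀ t, Integrable (discountedPayoff hT Y X f t) P)
    (hc : IsDefaultFreePrice hT P F Y X f c) {t s : Set.Icc (0 : ℝ) T} (hts : t ≤ s) :
    (fun ω => discount hT Y t s ω * c s ω) =ᵐ[P] P[discountedPayoff hT Y X f t | F s] := by
  have h : discount hT Y t s * discountedPayoff hT Y X f s =ᵐ[P] discountedPayoff hT Y X f t := by
    filter_upwards [hYi] with ω hω
    rw [Pi.mul_apply, discountedPayoff, discountedPayoff, ← mul_assoc,
      discount_mul_discount hω t.2 s.2 (Set.right_mem_Icc.2 hT)]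
  have h2 : P[discount hT Y t s * discountedPayoff hT Y X f s | F s] =ᵐ[P]
      discount hT Y t s * P[discountedPayoff hT Y X f s | F s] :=
    condExp_mul_of_stronglyMeasurable_left (stronglyMeasurable_discount hY hts)
      ((integrable_congr h).2 (hpayoff t)) (hpayoff s)
  filter_upwards [h2, condExp_congr_ae (m := F s) h, hc.price s] with ω e1 e2 e3
  rw [← e2, e1, e3, Pi.mul_apply]

/-- The discount factor of the intensity is a ratio of conditional survival probabilities. -/
theorem discount_mul_survival_ae_eq {τ : Ω → ℝ≥0∞} {lam : Set.Icc (0 : ℝ) T → Ω → ℝ}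
    (hF_lt : ∀ t, ∀ᵐ ω ∂P, condDefaultProb P F τ t ω < 1)
    (hlam_int : IntegrablePaths hT P lam)
    (hlam : ∀ t : Set.Icc (0 : ℝ) T, ∀ᵐ ω ∂P, hazard P F τ t ω = pathIntegral hT lam 0 t ω)
    (t : Set.Icc (0 : ℝ) T) :
    ∀ᵐ ω ∂P, discount hT lam t T ω * (1 - condDefaultProb P F τ t ω) =
      1 - condDefaultProb P F τ (maturity hT) ω := by
  filter_upwards [hF_lt t, hF_lt (maturity hT), hlam_int, hlam t, hlam (maturity hT)]
    with ω h1 h2 h3 h4 h5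
  have key : ∀ s : Set.Icc (0 : ℝ) T, condDefaultProb P F τ s ω < 1 →
      hazard P F τ s ω = pathIntegral hT lam 0 s ω →
      discount hT lam 0 s ω = 1 - condDefaultProb P F τ s ω := fun s hs hs' => by
    rw [discount, ← hs', hazard, neg_neg, Real.exp_log (sub_pos.2 hs)]
  rw [← key t h1 h4, ← key _ h2 h5, mul_comm]
  exact discount_mul_discount h3 (Set.left_mem_Icc.2 hT) t.2 (Set.right_mem_Icc.2 hT)

/-- The discount factor of λ is almost surely (1-F_T)/(1-F_t). This ratio supplies its
measurability, and the monotonicity of F its bound by 1. -/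
theorem integrable_mul_discount [IsProbabilityMeasure P] {τ : Ω → ℝ≥0∞} (hτ : Measurable τ)
    (hH : HHypothesis P F (enlarged F hτ)) {lam : Set.Icc (0 : ℝ) T → Ω → ℝ}
    (hF_lt : ∀ t, ∀ᵐ ω ∂P, condDefaultProb P F τ t ω < 1)
    {t : Set.Icc (0 : ℝ) T}
    (hD : ∀ᵐ ω ∂P, discount hT lam t T ω * (1 - condDefaultProb P F τ t ω) =
      1 - condDefaultProb P F τ (maturity hT) ω)
    {ξ : Ω → ℝ} (hξ : Integrable ξ P) :
    Integrable (fun ω => ξ ω * discount hT lam t T ω) P := by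
  have hm : ∀ s, AEStronglyMeasurable (fun ω => 1 - condDefaultProb P F τ s ω) P := fun s =>
    (stronglyMeasurable_const.sub
      (stronglyMeasurable_condExp.mono (F.le s))).aestronglyMeasurable
  have heq : discount hT lam t T =ᵐ[P] fun ω =>
      (1 - condDefaultProb P F τ (maturity hT) ω) / (1 - condDefaultProb P F τ t ω) := by
    filter_upwards [hD, hF_lt t] with ω h1 h2
    rw [← h1, mul_div_cancel_right₀ _ (sub_pos.2 h2).ne']
  refine hξ.mul_bdd (c := 1)
    (((hm _).aemeasurable.div (hm _).aemeasurable).aestronglyMeasurable.congr heq.symm) ?_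
  filter_upwards [hD, hF_lt t, condDefaultProb_mono hT hτ hH t] with ω h1 h2 h3
  rw [Real.norm_eq_abs, abs_of_nonneg (show 0 ≤ discount hT lam t T ω from (Real.exp_pos _).le)]
  refine le_of_mul_le_mul_right ?_ (sub_pos.2 h2)
  rw [h1, one_mul]
  linarith

end Discount

end CVA

/-! ### The pricing formulas. -/

theorem mainTheorem3 {Ω : Type*} {m : MeasurableSpace Ω} (P : Measure Ω) [IsProbabilityMeasure P]
    {T : ℝ} (hT : 0 ≤ T) (F : Filtration (Set.Icc (0 : ℝ) T) m)
    (r X lam c : Set.Icc (0 : ℝ) T → Ω → ℝ) (f : ℝ → ℝ) (R : ℝ)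
    (τ : Ω → ℝ≥0∞) (hτ : Measurable τ)
    -- the short rate, the log-price and the payoff function
    (hr : IsStronglyProgressive F r) (hr_int : CVA.IntegrablePaths hT P r)
    (hX : StronglyAdapted F X) (hf : Measurable f)
    (hpayoff : ∀ t, Integrable (CVA.discountedPayoff hT r X f t) P)
    -- the H-hypothesis
    (hH : CVA.HHypothesis P F (CVA.enlarged F hτ))
    -- the hazard process is well defined, and it has the intensity `lam`
    (hF_lt : ∀ t, ∀ᵐ ω ∂P, CVA.condDefaultProb P F τ t ω < 1)
    (hlam_int : CVA.IntegrablePaths hT P lam)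
    (hlam : ∀ t : Set.Icc (0 : ℝ) T, ∀ᵐ ω ∂P,
      CVA.hazard P F τ t ω = CVA.pathIntegral hT lam 0 t ω)
    -- fractional recovery `Z_t = R c(t, T)`
    (hR0 : 0 ≤ R) (hR1 : R < 1)
    (hc : CVA.IsDefaultFreePrice hT P F r X f c) (t : Set.Icc (0 : ℝ) T) :
    -- the random variables below are integrable, so all conditional expectations make sense
    Integrable (CVA.defaultablePayoff hT r X f τ (fun s ω => R * c s ω) t) P ∧
    Integrable (CVA.discountedPayoff hT (fun u ω => r u ω + lam u ω) X f t) P ∧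
    Integrable (fun ω => CVA.discountedPayoff hT r X f t ω *
      (1 - CVA.discount hT lam t T ω)) P ∧
    -- the defaultable price
    CVA.defaultablePrice hT P (CVA.enlarged F hτ) r X f τ (fun s ω => R * c s ω) t =ᵐ[P]
      (CVA.survivesPast τ t).indicator (fun ω =>
        R * (P[CVA.discountedPayoff hT r X f t | F t]) ω +
        (1 - R) * (P[CVA.discountedPayoff hT (fun u ω => r u ω + lam u ω) X f t | F t]) ω) ∧
    -- the credit valuation adjustment
    CVA.cva τ c (CVA.defaultablePrice hT P (CVA.enlarged F hτ) r X f τ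
        (fun s ω => R * c s ω)) t =ᵐ[P]
      (CVA.survivesPast τ t).indicator (fun ω =>
        (1 - R) * (P[fun ω' => CVA.discountedPayoff hT r X f t ω' *
          (1 - CVA.discount hT lam t T ω') | F t]) ω) := by

  set ξ : Ω → ℝ := CVA.discountedPayoff hT r X f t with hξ
  set D : Ω → ℝ := CVA.discount hT lam t T with hD
  set G := CVA.enlarged F hτ with hG
  set U : Set Ω := CVA.survivesPast τ t with hU
  set UT : Set Ω := CVA.survivesPast τ T with hUT
  have hξi : Integrable ξ P := hpayoff t
  have hξm : StronglyMeasurable[F (CVA.maturity hT)] ξ :=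
    CVA.stronglyMeasurable_discountedPayoff hr hX hf t
  have hUTm : MeasurableSet UT := CVA.measurableSet_survivesPast hτ T
  have hUm : MeasurableSet[G t] U := by
    rw [hU, CVA.survivesPast_eq_compl]
    exact (CVA.measurableSet_enlarged_defaultBy hτ t).compl
  have hratio := CVA.discount_mul_survival_ae_eq hF_lt hlam_int hlam t
  have hξD : Integrable (fun ω => ξ ω * D ω) P :=
    CVA.integrable_mul_discount hτ hH hF_lt hratio hξi
  have hadd : CVA.discountedPayoff hT (fun u ω => r u ω + lam u ω) X f t =ᵐ[P]
      fun ω => ξ ω * D ω := by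
    filter_upwards [hr_int, hlam_int] with ω h1 h2
    rw [CVA.discountedPayoff, CVA.discount_add h1 h2 t.2 (Set.right_mem_Icc.2 hT), hξ, hD,
      CVA.discountedPayoff]
    ring
  have hsub : (fun ω => ξ ω * (1 - D ω)) = ξ - fun ω => ξ ω * D ω := by
    ext ω
    simp only [Pi.sub_apply]
    ring
  -- the recovery payment
  set S : Set Ω := U ∩ CVA.defaultBy τ T with hS
  set V : Set.Icc (0 : ℝ) T → Ω → ℝ := fun s ω => CVA.discount hT r t s ω * c s ω with hV
  obtain ⟨hNi, hN⟩ := CVA.integrable_and_condExp_stopped hT (G := G)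
    (fun s => CVA.measurableSet_enlarged_defaultBy hτ s) hξi (V := V) (t := t)
    (fun s hts => (CVA.discount_mul_price_ae_eq hr hr_int hpayoff hc hts).trans
      (hH.condExp_ae_eq hT hξm hξi s).symm) (by
        filter_upwards [hr_int, hc.cadlag] with ω h1 h2 s
        exact (CVA.continuous_discount h1 t).continuousWithinAt.mul (h2 s).1)
  set N : Ω → ℝ := S.indicator fun ω => V (Set.projIcc 0 T hT (τ ω).toReal) ω with hNdef
  -- On `S` the default time lies in [0, T], so projecting it to the interval leaves it unchanged
  -- and the recovery payment is R times the stopped martingale `V`.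
  have hpay : CVA.defaultablePayoff hT r X f τ (fun s ω => R * c s ω) t =
      UT.indicator ξ + R • N := by
    ext ω
    simp only [CVA.defaultablePayoff, Pi.add_apply, Pi.smul_apply, smul_eq_mul]
    congr 1
    by_cases hω : ω ∈ S
    · have hle : (τ ω).toReal ≤ T := ENNReal.toReal_le_of_le_ofReal hT hω.2
      rw [hNdef, Set.indicator_of_mem hω, Set.indicator_of_mem hω]
      simp only [hV, Set.IccExtend, Function.comp_apply]
      rw [Set.projIcc_of_mem hT ⟨ENNReal.toReal_nonneg, hle⟩]
      ring
    · rw [hNdef, Set.indicator_of_notMem hω, Set.indicator_of_notMem hω, mul_zero]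
  have hSξ : S.indicator ξ = U.indicator ξ - UT.indicator ξ := by
    have h1 : S = U \ UT := by
      rw [hUT, CVA.survivesPast_eq_compl, Set.sdiff_compl]
    rw [h1, Set.indicator_sdiff (CVA.survivesPast_subset t.2.2)]
  have hprice : CVA.defaultablePrice hT P G r X f τ (fun s ω => R * c s ω) t =ᵐ[P]
      U.indicator (fun ω => R * (P[ξ | F t]) ω +
        (1 - R) * (P[fun ω => ξ ω * D ω | F t]) ω) := by
    rw [CVA.defaultablePrice, hpay]
    have e1 := condExp_add (hξi.indicator hUTm) (hNi.smul R) (G t)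
    have e2 := condExp_smul (μ := P) R N (G t)
    have e3 := condExp_sub (hξi.indicator (G.le t _ hUm)) (hξi.indicator hUTm) (G t)
    rw [← hSξ] at e3
    have e4 := condExp_indicator (m := G t) hξi hUm
    have e5 := CVA.condExp_indicator_survivesPast hT hτ hF_lt hξm hξi hratio hξD
    filter_upwards [e1, e2, hN, e3, e4, e5, hH.condExp_ae_eq hT hξm hξi t]
      with ω a1 a2 a3 a4 a5 a6 a7
    -- After optional stopping, the price is E[ξ 1_UT | G_t] + R (1_U E[ξ | G_t] - E[ξ 1_UT | G_t]);
    -- `a7` will replace G_t by F_t in the middle term.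
    rw [a1, Pi.add_apply, a2, Pi.smul_apply, a3, a4, Pi.sub_apply, a5, a6, smul_eq_mul]
    by_cases hω : ω ∈ U
    · rw [Set.indicator_of_mem hω, Set.indicator_of_mem hω, Set.indicator_of_mem hω, a7]
      ring
    · rw [Set.indicator_of_notMem hω, Set.indicator_of_notMem hω, Set.indicator_of_notMem hω]
      ring
  refine ⟨?_, (integrable_congr hadd).2 hξD, ?_, ?_, ?_⟩
  · rw [hpay]
    exact (hξi.indicator hUTm).add (hNi.smul R)
  · rw [hsub]
    exact hξi.sub hξD
  · filter_upwards [hprice, condExp_congr_ae (m := F t) hadd] with ω h1 h2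
    rw [h1]
    simp only [Set.indicator, h2]
  · rw [hsub]
    filter_upwards [hprice, hc.price t, condExp_sub hξi hξD (F t)] with ω h1 h2 h3
    rw [CVA.cva]
    by_cases hω : ω ∈ U
    · rw [Set.indicator_of_mem hω, Set.indicator_of_mem hω, Pi.sub_apply, h1, h2, h3,
        Set.indicator_of_mem hω, Pi.sub_apply]
      ring
    · rw [Set.indicator_of_notMem hω, Set.indicator_of_notMem hω]
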